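/- For a commutative ring $R$ and a (unital, associative) $R$-algebra $A$, let $$\zeta_A(s)=\sum_{I} |A:I|^{-s}$$ be its ideal zeta function, the sum being over all two-sided ideals $I$ of $A$ that are $R$-submodules and have finite index $|A:I|$ in $A$. Let $n\ge 1$ be an integer. (i) For every prime $p$, the ideal zeta function of the $\mathbf{Z}_p$-algebra $\mathbf{Z}_p[X]/(X^n)$ converges absolutely for all $s\in\mathbf{C}$ with $\mathrm{Re}(s)>1-\frac1n$, and there $$\zeta_{\mathbf{Z}_p[X]/(X^n)}(s)=\frac{1}{\prod_{j=1}^n\bigl(1-p^{\,j-1-js}\bigr)}.$$ (ii) The ideal zeta function of $\mathbf{Z}[X]/(X^n)$ (as a $\mathbf{Z}$-algebra) converges absolutely for all $s\in\mathbf{C}$ with $\mathrm{Re}(s)>1$, and there $$\zeta_{\mathbf{Z}[X]/(X^n)}(s)=\prod_{j=1}^n\zeta(js-j+1),$$ where $\zeta$ denotes the Riemann zeta function. -/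

import Mathlib

open Polynomial

/-- The two-sided ideals of finite index of a (unital, associative) `R`-algebra `A` that are
also `R`-submodules. -/
def finiteIndexIdeals (R A : Type*) [CommRing R] [Ring A] [Algebra R A] :
    Set (Submodule R A) :=
  {I | (∀ a : A, ∀ x ∈ I, a * x ∈ I ∧ x * a ∈ I) ∧ Finite (A ⧸ I)}

/-- The summand `|A : I| ^ (-s)` of the ideal zeta function. -/
noncomputable def idealZetaTerm (R A : Type*) [CommRing R] [Ring A] [Algebra R A]
    (s : ℂ) (I : finiteIndexIdeals R A) : ℂ :=
  (Nat.card (A ⧸ (I : Submodule R A)) : ℂ) ^ (-s)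

/-- The ideal zeta function of the `R`-algebra `A`: the sum of `|A : I| ^ (-s)` over all two-sided
ideals `I` of finite index that are `R`-submodules (meaningful where the series converges
absolutely). -/
noncomputable def idealZeta (R A : Type*) [CommRing R] [Ring A] [Algebra R A]
    (s : ℂ) : ℂ :=
  ∑' I : finiteIndexIdeals R A, idealZetaTerm R A s I

/-- The truncated polynomial ring `R[X]/(X ^ n)`. -/
abbrev TruncatedPolynomial (R : Type*) [CommRing R] (n : ℕ) : Type _ :=
  R[X] ⧸ Ideal.span {(X : R[X]) ^ n}

/-! Ideals of `R[X]/(X ^ n)` are ideals `I ∋ X ^ n` of `R[X]`. Put `J = (I : X)`, which contains `X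
^ (n - 1)`, and let `I₀` be the ideal of constant coefficients. Then `|R[X] : I| = |R[X] : J| * |R :
I₀|` (`cardQuot_eq_colonX_mul_constIdeal`), and `I ≤ J` gives `I₀ = J₀ * D` when `R` is a principal
ideal domain. For given `J` and `D` there are exactly `|R : J₀|` such `I`, whatever `D` is
(`natCard_colonX_constIdeal`). Hence `Z_n(s, t) = ∑ |R[X] : I| ^ (-s) * |R : I₀| ^ (-t)` satisfies
`Z_n(s, t) = ζ_R(s + t) * Z_{n-1}(s, s + t - 1)`. Iterating from `t = 0` gives `∏ ζ_R(j s - j + 1)`,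
where `ζ_R` is Riemann's zeta function for `ℤ` and a geometric series for `ℤ_[p]`. -/

namespace Polynomial

/-! ### Ideals of `R[X]` described by colon ideal and constant terms. -/

section Ring

variable {R : Type*} [CommRing R]

/-- The ideal quotient `(I : X)`. -/
noncomputable def colonX (I : Ideal R[X]) : Ideal R[X] :=
  Submodule.comap (LinearMap.mulLeft R[X] (X : R[X])) I

@[simp]
theorem mem_colonX {I : Ideal R[X]} {f : R[X]} : f ∈ colonX I ↔ X * f ∈ I := Iff.rfl

theorem le_colonX (I : Ideal R[X]) : I ≤ colonX I := fun _ hf => I.mul_mem_left _ hf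

/-- The ideal of constant coefficients of the elements of `I`. -/
noncomputable def constIdeal (I : Ideal R[X]) : Ideal R := I.map constantCoeff

theorem mem_constIdeal {I : Ideal R[X]} {a : R} :
    a ∈ constIdeal I ↔ ∃ f ∈ I, constantCoeff f = a :=
  Ideal.mem_map_iff_of_surjective _ constantCoeff_surjective

theorem constIdeal_mono {I J : Ideal R[X]} (h : I ≤ J) : constIdeal I ≤ constIdeal J :=
  Ideal.map_mono h

theorem exists_eq_C_add_X_mul (f : R[X]) : ∃ g : R[X], f = C (constantCoeff f) + X * g :=
  ⟨f.divX, by rw [add_comm, constantCoeff_apply, mul_comm, divX_mul_X_add]⟩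

/-- Multiplication by `X` embeds `R[X]/(I : X)` in `R[X]/I` with cokernel `R[X]/(I + (X)) ≅ R/I₀`.
-/
theorem cardQuot_eq_colonX_mul_constIdeal (I : Ideal R[X]) :
    Submodule.cardQuot I = Submodule.cardQuot (colonX I) * Submodule.cardQuot (constIdeal I) := by
  let m : R[X] →+ R[X] := AddMonoidHom.mulLeft X
  have h1 : Submodule.cardQuot (colonX I) = I.toAddSubgroup.relIndex m.range := by
    rw [← AddSubgroup.index_comap]; rfl
  have h2 : Submodule.cardQuot (constIdeal I) = (I.toAddSubgroup ⊔ m.range).index := by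
    rw [Submodule.cardQuot,
      ← AddSubgroup.index_comap_of_surjective (f := (constantCoeff : R[X] →+* R).toAddMonoidHom)
        _ constantCoeff_surjective]
    congr 1
    ext f
    rw [AddSubgroup.mem_sup]
    change constantCoeff f ∈ constIdeal I ↔ _
    rw [mem_constIdeal]
    constructor
    · rintro ⟨g, hg, hgf⟩
      obtain ⟨u, hu⟩ := exists_eq_C_add_X_mul (f - g)
      refine ⟨g, hg, X * u, ⟨u, rfl⟩, ?_⟩
      rw [map_sub, hgf, sub_self, map_zero, zero_add] at hu
      rw [← hu]; ring
    · rintro ⟨g, hg, _, ⟨u, rfl⟩, rfl⟩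
      exact ⟨g, hg, by simp [m]⟩
  rw [h1, h2, ← AddSubgroup.relIndex_sup_right, sup_comm, AddSubgroup.relIndex_mul_index le_sup_left]
  rfl

/-- The ideal of `R[X]` generated by `a + X g` and `X J`. -/
noncomputable def liftIdeal (J : Ideal R[X]) (a : R) (g : R[X]) : Ideal R[X] :=
  Ideal.span {C a + X * g} ⊔ Ideal.span {X} * J

theorem mem_liftIdeal {J : Ideal R[X]} {a : R} {g f : R[X]} :
    f ∈ liftIdeal J a g ↔ ∃ h, ∃ j ∈ J, h * (C a + X * g) + X * j = f := by
  rw [liftIdeal, Ideal.mem_span_singleton_sup]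
  simp only [Ideal.mem_span_singleton_mul]
  constructor
  · rintro ⟨h, _, ⟨j, hj, rfl⟩, e⟩
    exact ⟨h, j, hj, e⟩
  · rintro ⟨h, j, hj, e⟩
    exact ⟨h, _, ⟨j, hj, rfl⟩, e⟩

theorem generator_mem_liftIdeal (J : Ideal R[X]) (a : R) (g : R[X]) :
    C a + X * g ∈ liftIdeal J a g :=
  mem_liftIdeal.2 ⟨1, 0, J.zero_mem, by ring⟩

theorem constIdeal_liftIdeal (J : Ideal R[X]) (a : R) (g : R[X]) :
    constIdeal (liftIdeal J a g) = Ideal.span {a} := by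
  ext b
  rw [mem_constIdeal, Ideal.mem_span_singleton']
  constructor
  · rintro ⟨f, hf, rfl⟩
    obtain ⟨h, j, -, rfl⟩ := mem_liftIdeal.1 hf
    exact ⟨constantCoeff h, by simp⟩
  · rintro ⟨r, rfl⟩
    exact ⟨C r * (C a + X * g), Ideal.mul_mem_left _ _ (generator_mem_liftIdeal J a g), by simp⟩

/-- Subtracting a multiple of `C a + X * g` from an element of `I` kills its constant term and
leaves `X` times an element of `(I : X)`. -/
theorem eq_liftIdeal {I : Ideal R[X]} {a : R} {g : R[X]} (hI : constIdeal I = Ideal.span {a})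
    (hg : C a + X * g ∈ I) : I = liftIdeal (colonX I) a g := by
  ext f
  rw [mem_liftIdeal]
  constructor
  · intro hf
    have : constantCoeff f ∈ Ideal.span {a} := hI ▸ mem_constIdeal.2 ⟨f, hf, rfl⟩
    obtain ⟨r, hr⟩ := Ideal.mem_span_singleton'.1 this
    obtain ⟨u, hu⟩ := exists_eq_C_add_X_mul f
    have e : C r * (C a + X * g) + X * (u - C r * g) = f := by
      rw [hu, ← hr, map_mul]; ring
    refine ⟨C r, u - C r * g, ?_, e⟩
    rw [mem_colonX, ← add_sub_cancel_left (C r * (C a + X * g)) (X * _), e]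
    exact I.sub_mem hf (I.mul_mem_left _ hg)
  · rintro ⟨h, j, hj, rfl⟩
    exact I.add_mem (I.mul_mem_left _ hg) hj

end Ring

section Domain

variable {R : Type*} [CommRing R] [IsDomain R]

/-- Comparing constant terms in `X * f = h * (C a + X * g) + X * j` forces `X ∣ h`, and `X` can then
be cancelled. -/
theorem colonX_liftIdeal {J : Ideal R[X]} {a : R} {g : R[X]} (ha : a ≠ 0)
    (hg : C a + X * g ∈ J) : colonX (liftIdeal J a g) = J := by
  ext f
  rw [mem_colonX, mem_liftIdeal]
  constructor
  · rintro ⟨h, j, hj, e⟩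
    obtain ⟨u, hu⟩ := exists_eq_C_add_X_mul h
    have h0 : constantCoeff h = 0 := by
      have := congrArg constantCoeff e
      simp only [map_add, map_mul, constantCoeff_apply, coeff_C_zero, coeff_X_zero, zero_mul,
        add_zero] at this
      exact (mul_eq_zero.1 this).resolve_right ha
    rw [h0, map_zero, zero_add] at hu
    have : X * f = X * (u * (C a + X * g) + j) := by rw [← e, hu]; ring
    rw [mul_left_cancel₀ X_ne_zero this]
    exact J.add_mem (J.mul_mem_left _ hg) hj
  · intro hf
    exact ⟨0, f, hf, by ring⟩

theorem liftIdeal_eq_iff {J : Ideal R[X]} {a : R} {g g' : R[X]} (ha : a ≠ 0)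
    (hg : C a + X * g ∈ J) :
    liftIdeal J a g = liftIdeal J a g' ↔ g' - g ∈ J := by
  have hJ := colonX_liftIdeal ha hg
  constructor
  · intro e
    rw [← hJ, mem_colonX]
    have h := (liftIdeal J a g).sub_mem (e ▸ generator_mem_liftIdeal J a g')
      (generator_mem_liftIdeal J a g)
    convert h using 1; ring
  · intro h
    have h' : C a + X * g' ∈ liftIdeal J a g := mem_liftIdeal.2 ⟨1, g' - g, h, by ring⟩
    have := eq_liftIdeal (constIdeal_liftIdeal J a g) h'
    rwa [hJ] at this

/-- The number of ideals `I` with prescribed `(I : X) = J` and prescribed constant coefficients. -/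
theorem natCard_colonX_constIdeal {J : Ideal R[X]} (hJ : Submodule.cardQuot J ≠ 0) {a : R}
    (ha : a ≠ 0) (haJ : a ∈ constIdeal J) :
    Nat.card {I : Ideal R[X] // colonX I = J ∧ constIdeal I = Ideal.span {a}} =
      Submodule.cardQuot (constIdeal J) := by
  obtain ⟨f, hf, rfl⟩ := mem_constIdeal.1 haJ
  obtain ⟨g, hg⟩ := exists_eq_C_add_X_mul f
  set a := constantCoeff f
  have hgJ : C a + X * g ∈ J := hg ▸ hf
  have key (k : (colonX J).toAddSubgroup) : C a + X * (g + (k : R[X])) ∈ J := by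
    rw [mul_add, ← add_assoc]; exact J.add_mem hgJ k.2
  -- The admissible `g` form a coset of `(J : X)`, and two of them give the same ideal exactly when
  -- they differ by an element of `J`.
  let Q := (colonX J).toAddSubgroup ⧸ (J.toAddSubgroup.addSubgroupOf (colonX J).toAddSubgroup)
  let F (k : (colonX J).toAddSubgroup) :
      {I : Ideal R[X] // colonX I = J ∧ constIdeal I = Ideal.span {a}} :=
    ⟨liftIdeal J a (g + (k : R[X])), colonX_liftIdeal ha (key k), constIdeal_liftIdeal _ _ _⟩
  have hF (k k') : F k = F k' ↔ (k : Q) = (k' : Q) := by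
    rw [QuotientAddGroup.eq, AddSubgroup.mem_addSubgroupOf, Subtype.mk.injEq,
      liftIdeal_eq_iff ha (key k)]
    change _ ↔ -(k : R[X]) + k' ∈ J
    rw [show g + (k' : R[X]) - (g + k) = -(k : R[X]) + k' by ring]
  have hsurj : Function.Surjective F := by
    rintro ⟨I, hIJ, hIa⟩
    obtain ⟨q, hq, hqa⟩ := mem_constIdeal.1 (hIa ▸ Ideal.mem_span_singleton_self a)
    obtain ⟨u, hu⟩ := exists_eq_C_add_X_mul q
    rw [hqa] at hu
    have huJ : q ∈ J := hIJ ▸ le_colonX I hq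
    refine ⟨⟨u - g, ?_⟩, ?_⟩
    · change X * (u - g) ∈ J
      have := J.sub_mem huJ hgJ
      rw [hu] at this
      convert this using 1; ring
    · apply Subtype.ext
      change liftIdeal J a (g + (u - g)) = I
      rw [add_sub_cancel, eq_liftIdeal hIa (hu ▸ hq), hIJ]
  have e : Q ≃ {I : Ideal R[X] // colonX I = J ∧ constIdeal I = Ideal.span {a}} := by
    refine Equiv.ofBijective (Quotient.lift F fun k k' h => (hF k k').2 (Quotient.sound h)) ⟨?_, ?_⟩
    · rintro ⟨k⟩ ⟨k'⟩ h
      exact (hF k k').1 h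
    · intro I
      obtain ⟨k, rfl⟩ := hsurj I
      exact ⟨(k : Q), rfl⟩
  rw [← Nat.card_congr e]
  -- `|(J : X) : J| = |R : J₀|`: both equal `|R[X] : J|` after multiplication by the nonzero `|R[X]
  -- : (J : X)|`.
  have h1 := cardQuot_eq_colonX_mul_constIdeal J
  have h2 := AddSubgroup.relIndex_mul_index
    (show J.toAddSubgroup ≤ (colonX J).toAddSubgroup from le_colonX J)
  have h3 : Submodule.cardQuot (colonX J) ≠ 0 := fun h => hJ (by rw [h1, h, zero_mul])
  apply Nat.eq_of_mul_eq_mul_right (Nat.pos_of_ne_zero h3)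
  rw [mul_comm (Submodule.cardQuot (constIdeal J)), ← h1]
  exact h2

end Domain

end Polynomial

/-! ### Products and sums over fibres. -/

theorem Finset.prod_Icc_one_succ {M : Type*} [CommMonoid M] (f : ℕ → M) (n : ℕ) :
    ∏ j ∈ Finset.Icc 1 (n + 1), f j = f 1 * ∏ j ∈ Finset.Icc 1 n, f (j + 1) := by
  induction n with
  | zero => simp
  | succ n ih =>
    rw [Finset.prod_Icc_succ_top (by omega), ih, Finset.prod_Icc_succ_top (by omega), mul_assoc]

/-- Summation over the fibres of a map with finite nonempty fibres. -/
theorem summable_comp_and_tsum_comp_of_natCard_fiber {α β : Type*} (π : α → β) (c : β → ℕ)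
    (hc : ∀ y, Nat.card {x // π x = y} = c y) (hc0 : ∀ y, c y ≠ 0) (g : β → ℂ)
    (hg : Summable fun y => (c y : ℂ) * g y) :
    Summable (fun x => g (π x)) ∧ ∑' x, g (π x) = ∑' y, (c y : ℂ) * g y := by
  let e := Equiv.sigmaFiberEquiv π
  have hfin (y) : Finite {x // π x = y} :=
    Nat.finite_of_card_ne_zero (by rw [hc]; exact hc0 y)
  have he (z : Σ y, {x // π x = y}) : g (π (e z)) = g z.1 := congrArg g z.2.2
  have hs : Summable fun z : Σ y, {x // π x = y} => g z.1 := by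
    apply Summable.of_norm
    rw [summable_sigma_of_nonneg fun _ => norm_nonneg _]
    refine ⟨fun y => Summable.of_finite, ?_⟩
    convert hg.norm using 2 with y
    simp [tsum_const, hc]
  constructor
  · rw [← e.summable_iff]
    exact hs.congr fun z => (he z).symm
  · rw [← e.tsum_eq, tsum_congr he, hs.tsum_sigma]
    exact tsum_congr fun y => by simp [tsum_const, hc]

/-! ### The recursion for the two-variable series over a principal ideal domain. -/

section PrincipalIdealRing

variable {R : Type*} [CommRing R]

/-- Multiplication by `a` identifies `R/D` with `aR/aD`. -/
theorem Submodule.cardQuot_span_singleton_mul [IsDomain R] {a : R} (ha : a ≠ 0) (D : Ideal R) :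
    Submodule.cardQuot (Ideal.span {a} * D) =
      Submodule.cardQuot (Ideal.span {a}) * Submodule.cardQuot D := by
  let m : R →+ R := AddMonoidHom.mulLeft a
  have hm : m.range = (Ideal.span {a}).toAddSubgroup := by
    ext x
    change (∃ y, a * y = x) ↔ x ∈ Ideal.span {a}
    rw [Ideal.mem_span_singleton]
    exact ⟨fun ⟨y, h⟩ => ⟨y, h.symm⟩, fun ⟨y, h⟩ => ⟨y, h.symm⟩⟩
  have hD : (Ideal.span {a} * D).toAddSubgroup.comap m = D.toAddSubgroup := by
    ext x
    change a * x ∈ Ideal.span {a} * D ↔ x ∈ D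
    rw [Ideal.mem_span_singleton_mul]
    exact ⟨fun ⟨y, hy, h⟩ => mul_left_cancel₀ ha h ▸ hy, fun h => ⟨x, h, rfl⟩⟩
  have h := AddSubgroup.relIndex_mul_index
    (show (Ideal.span {a} * D).toAddSubgroup ≤ (Ideal.span {a}).toAddSubgroup from
      fun x hx => (show Ideal.span {a} * D ≤ Ideal.span {a} from Ideal.mul_le_left) hx)
  rw [← hm, ← AddSubgroup.index_comap, hD, hm, mul_comm] at h
  exact h.symm

theorem Submodule.cardQuot_bot_of_infinite [Infinite R] :
    Submodule.cardQuot (⊥ : Ideal R) = 0 := by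
  rw [Submodule.cardQuot_bot]

variable (R) in
/-- The summand `|R : D| ^ (-w)` of the ideal zeta function of the commutative ring `R`. -/
noncomputable def cardQuotTerm (w : ℂ) (D : {D : Ideal R // Submodule.cardQuot D ≠ 0}) : ℂ :=
  (Submodule.cardQuot D.1 : ℂ) ^ (-w)

variable (R) in
/-- The ideals of finite index of `R[X]` that contain `X ^ n`. -/
abbrev TruncIdeal (n : ℕ) : Type _ :=
  {I : Ideal R[X] // (X : R[X]) ^ n ∈ I ∧ Submodule.cardQuot I ≠ 0}

variable (R) in
/-- The two-variable summand `|R[X] : I| ^ (-s) * |R : I₀| ^ (-t)`, where `I₀` is the ideal of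
constant coefficients of `I`. -/
noncomputable def truncTerm (n : ℕ) (s t : ℂ) (I : TruncIdeal R n) : ℂ :=
  (Submodule.cardQuot I.1 : ℂ) ^ (-s) * (Submodule.cardQuot (constIdeal I.1) : ℂ) ^ (-t)

namespace TruncIdeal

theorem cardQuot_colonX_ne_zero {n : ℕ} (I : TruncIdeal R n) :
    Submodule.cardQuot (colonX I.1) ≠ 0 :=
  left_ne_zero_of_mul (cardQuot_eq_colonX_mul_constIdeal I.1 ▸ I.2.2)

theorem cardQuot_constIdeal_ne_zero {n : ℕ} (I : TruncIdeal R n) :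
    Submodule.cardQuot (constIdeal I.1) ≠ 0 :=
  right_ne_zero_of_mul (cardQuot_eq_colonX_mul_constIdeal I.1 ▸ I.2.2)

/-- The ideal quotient `(I : X)` of an ideal containing `X ^ (n + 1)`. -/
noncomputable def colon {n : ℕ} (I : TruncIdeal R (n + 1)) : TruncIdeal R n :=
  ⟨colonX I.1, by rw [mem_colonX, ← pow_succ']; exact I.2.1, I.cardQuot_colonX_ne_zero⟩

variable [IsDomain R] [IsPrincipalIdealRing R] [Infinite R]

omit [IsDomain R] [IsPrincipalIdealRing R] in
theorem constIdeal_ne_bot {n : ℕ} (I : TruncIdeal R n) : constIdeal I.1 ≠ ⊥ := fun h =>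
  I.cardQuot_constIdeal_ne_zero (h ▸ Submodule.cardQuot_bot_of_infinite)

theorem cardQuot_constIdeal_mul {n : ℕ} (I : TruncIdeal R n) (D : Ideal R) :
    Submodule.cardQuot (constIdeal I.1 * D) =
      Submodule.cardQuot (constIdeal I.1) * Submodule.cardQuot D := by
  obtain ⟨a, ha⟩ := IsPrincipalIdealRing.principal (constIdeal I.1)
  have h0 := I.constIdeal_ne_bot
  rw [ha] at h0 ⊢
  exact Submodule.cardQuot_span_singleton_mul (fun h => h0 (by simp [h])) D

theorem exists_constIdeal_eq_mul {n : ℕ} (I : TruncIdeal R (n + 1)) :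
    ∃ D : {D : Ideal R // Submodule.cardQuot D ≠ 0},
      constIdeal I.1 = constIdeal I.colon.1 * D.1 := by
  obtain ⟨D, hD⟩ := Ideal.dvd_iff_le.2 (constIdeal_mono (le_colonX I.1))
  refine ⟨⟨D, fun h => I.cardQuot_constIdeal_ne_zero ?_⟩, hD⟩
  have := I.colon.cardQuot_constIdeal_mul D
  rw [h, mul_zero] at this
  exact hD ▸ this

/-- The ideal `D` with `I₀ = (I : X)₀ * D`, where the subscript denotes constant coefficients. -/
noncomputable def quot {n : ℕ} (I : TruncIdeal R (n + 1)) :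
    {D : Ideal R // Submodule.cardQuot D ≠ 0} :=
  I.exists_constIdeal_eq_mul.choose

theorem constIdeal_eq_mul_quot {n : ℕ} (I : TruncIdeal R (n + 1)) :
    constIdeal I.1 = constIdeal I.colon.1 * I.quot.1 :=
  I.exists_constIdeal_eq_mul.choose_spec

theorem colon_quot_eq_iff {n : ℕ} (I : TruncIdeal R (n + 1)) (J : TruncIdeal R n)
    (D : {D : Ideal R // Submodule.cardQuot D ≠ 0}) :
    (I.colon, I.quot) = (J, D) ↔ colonX I.1 = J.1 ∧ constIdeal I.1 = constIdeal J.1 * D.1 := by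
  constructor
  · rintro h
    obtain ⟨rfl, rfl⟩ := Prod.mk.inj h
    exact ⟨rfl, I.constIdeal_eq_mul_quot⟩
  · rintro ⟨h1, h2⟩
    obtain rfl : I.colon = J := Subtype.ext h1
    refine Prod.ext rfl (Subtype.ext ?_)
    rw [I.constIdeal_eq_mul_quot] at h2
    exact mul_left_cancel₀ I.colon.constIdeal_ne_bot h2

theorem natCard_fiber {n : ℕ} (y : TruncIdeal R n × {D : Ideal R // Submodule.cardQuot D ≠ 0}) :
    Nat.card {I : TruncIdeal R (n + 1) // (I.colon, I.quot) = y} =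
      Submodule.cardQuot (constIdeal y.1.1) := by
  obtain ⟨J, D⟩ := y
  have hc : Submodule.cardQuot (constIdeal J.1 * D.1) ≠ 0 := by
    rw [J.cardQuot_constIdeal_mul]
    exact mul_ne_zero J.cardQuot_constIdeal_ne_zero D.2
  obtain ⟨a, ha⟩ := IsPrincipalIdealRing.principal (constIdeal J.1 * D.1)
  have ha0 : a ≠ 0 := by
    rintro rfl
    rw [ha, Submodule.span_zero_singleton] at hc
    exact hc Submodule.cardQuot_bot_of_infinite
  have haJ : a ∈ constIdeal J.1 :=
    (show constIdeal J.1 * D.1 ≤ constIdeal J.1 from Ideal.mul_le_left)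
      (ha ▸ Submodule.mem_span_singleton_self a)
  rw [← natCard_colonX_constIdeal J.2.2 ha0 haJ]
  have hmem (I : Ideal R[X]) (h : colonX I = J.1 ∧ constIdeal I = Ideal.span {a}) :
      (X : R[X]) ^ (n + 1) ∈ I ∧ Submodule.cardQuot I ≠ 0 := by
    constructor
    · rw [pow_succ', ← mem_colonX, h.1]; exact J.2.1
    · rw [cardQuot_eq_colonX_mul_constIdeal, h.1, h.2]
      exact mul_ne_zero J.2.2 (by rw [ha] at hc; exact hc)
  refine Nat.card_congr
    { toFun := fun I => ⟨I.1.1, by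
        have := (colon_quot_eq_iff I.1 J D).1 I.2
        rwa [ha] at this⟩
      invFun := fun I => ⟨⟨I.1, hmem I.1 I.2⟩, by
        rw [colon_quot_eq_iff, ha]; exact I.2⟩
      left_inv := fun _ => rfl
      right_inv := fun _ => rfl }

-- The fibre size `|R : J₀|` is absorbed by lowering the second exponent by one.
omit [IsDomain R] [IsPrincipalIdealRing R] [Infinite R] in
theorem cardQuot_mul_truncTerm {n : ℕ} (s t : ℂ) (J : TruncIdeal R n) :
    (Submodule.cardQuot (constIdeal J.1) : ℂ) *
      ((Submodule.cardQuot J.1 : ℂ) ^ (-s) *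
        (Submodule.cardQuot (constIdeal J.1) : ℂ) ^ (-(s + t))) =
      truncTerm R n s (s + t - 1) J := by
  have h : (Submodule.cardQuot (constIdeal J.1) : ℂ) ≠ 0 :=
    Nat.cast_ne_zero.2 J.cardQuot_constIdeal_ne_zero
  rw [truncTerm, show -(s + t - 1) = 1 + -(s + t) by ring, Complex.cpow_add _ _ h,
    Complex.cpow_one]
  ring

theorem truncTerm_succ {n : ℕ} (s t : ℂ) (I : TruncIdeal R (n + 1)) :
    truncTerm R (n + 1) s t I =
      (Submodule.cardQuot I.colon.1 : ℂ) ^ (-s) *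
        (Submodule.cardQuot (constIdeal I.colon.1) : ℂ) ^ (-(s + t)) *
        cardQuotTerm R (s + t) I.quot := by
  have h1 : (Submodule.cardQuot (constIdeal I.colon.1) : ℂ) ≠ 0 :=
    Nat.cast_ne_zero.2 I.colon.cardQuot_constIdeal_ne_zero
  have h2 : (Submodule.cardQuot I.quot.1 : ℂ) ≠ 0 := Nat.cast_ne_zero.2 I.quot.2
  have hmul (a b : ℕ) (z : ℂ) : ((a * b : ℕ) : ℂ) ^ z = (a : ℂ) ^ z * (b : ℂ) ^ z := by
    rw [Nat.cast_mul, Complex.natCast_mul_natCast_cpow]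
  rw [truncTerm, cardQuot_eq_colonX_mul_constIdeal, I.constIdeal_eq_mul_quot,
    I.colon.cardQuot_constIdeal_mul, cardQuotTerm, neg_add, Complex.cpow_add _ _ h1,
    Complex.cpow_add _ _ h2]
  simp only [hmul, colon]
  ring

/-- `t` must vary in the induction, since the step replaces it by `s + t - 1`. -/
theorem summable_and_tsum_truncTerm (n : ℕ) (s t : ℂ)
    (h : ∀ j ∈ Finset.Icc 1 n, Summable (cardQuotTerm R (j * s - j + 1 + t))) :
    Summable (truncTerm R n s t) ∧
      ∑' I, truncTerm R n s t I =
        ∏ j ∈ Finset.Icc 1 n, ∑' D, cardQuotTerm R (j * s - j + 1 + t) D := by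
  induction n generalizing t with
  | zero =>
    -- As `X ^ 0 = 1`, only the unit ideal occurs.
    have hT (I : TruncIdeal R 0) : I.1 = ⊤ := (Ideal.eq_top_iff_one _).2 (by simpa using I.2.1)
    have : Unique (TruncIdeal R 0) :=
      { default := ⟨⊤, by simp, by simp⟩
        uniq := fun I => Subtype.ext (hT I) }
    refine ⟨Summable.of_finite, ?_⟩
    have hc : constIdeal (⊤ : Ideal R[X]) = ⊤ := Ideal.map_top _
    simp [truncTerm, hT, hc]
  | succ n ih =>
    -- The shift of `t` turns the `j`-th factor into the `(j + 1)`-st; the sum over `D` supplies the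
    -- factor for `1`.
    have hw (j : ℕ) : (j * s - j + 1 + (s + t - 1) : ℂ) = ((j + 1 : ℕ) : ℂ) * s - (j + 1 : ℕ) + 1 + t := by
      push_cast; ring
    obtain ⟨h1, h2⟩ := ih (s + t - 1) fun j hj => by
      rw [hw]
      exact h (j + 1) (by simp only [Finset.mem_Icc] at hj ⊢; omega)
    have h3 : Summable (cardQuotTerm R (s + t)) := by
      convert h 1 (by simp) using 2
      push_cast; ring
    let g (y : TruncIdeal R n × {D : Ideal R // Submodule.cardQuot D ≠ 0}) : ℂ :=
      (Submodule.cardQuot y.1.1 : ℂ) ^ (-s) *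
        (Submodule.cardQuot (constIdeal y.1.1) : ℂ) ^ (-(s + t)) * cardQuotTerm R (s + t) y.2
    have hg (y) : (Submodule.cardQuot (constIdeal y.1.1) : ℂ) * g y =
        truncTerm R n s (s + t - 1) y.1 * cardQuotTerm R (s + t) y.2 := by
      rw [← mul_assoc, cardQuot_mul_truncTerm]
    have h4 := summable_mul_of_summable_norm h1.norm h3.norm
    obtain ⟨h5, h6⟩ := summable_comp_and_tsum_comp_of_natCard_fiber
      (fun I : TruncIdeal R (n + 1) => (I.colon, I.quot)) _ natCard_fiber
      (fun y => y.1.cardQuot_constIdeal_ne_zero) g (h4.congr fun y => (hg y).symm)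
    refine ⟨h5.congr fun I => (truncTerm_succ s t I).symm, ?_⟩
    rw [tsum_congr (truncTerm_succ s t)]
    refine h6.trans ?_
    rw [tsum_congr hg, ← tsum_mul_tsum_of_summable_norm h1.norm h3.norm, h2]
    rw [Finset.prod_Icc_one_succ, mul_comm]
    congr 1
    · rw [show ((1 : ℕ) : ℂ) * s - (1 : ℕ) + 1 + t = s + t by push_cast; ring]
    · exact Finset.prod_congr rfl fun j _ => by rw [hw]

end TruncIdeal

end PrincipalIdealRing

/-! ### From `R[X]/(X ^ n)` to ideals of `R[X]`. -/

section Comparison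

variable {R : Type*} [CommRing R] {n : ℕ}

/-- The preimage in `R[X]` of an ideal of `R[X]/(X ^ n)`. -/
noncomputable def TruncatedPolynomial.pullback
    (I : finiteIndexIdeals R (TruncatedPolynomial R n)) : Ideal R[X] where
  carrier := {f | Ideal.Quotient.mk (Ideal.span {(X : R[X]) ^ n}) f ∈ I.1}
  add_mem' {f g} hf hg := by
    change Ideal.Quotient.mk _ (f + g) ∈ I.1
    rw [map_add]; exact I.1.add_mem hf hg
  zero_mem' := by
    change Ideal.Quotient.mk _ 0 ∈ I.1
    rw [map_zero]; exact I.1.zero_mem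
  smul_mem' c f hf := by
    change Ideal.Quotient.mk _ (c * f) ∈ I.1
    rw [map_mul]; exact (I.2.1 _ _ hf).1

namespace TruncatedPolynomial

theorem mem_pullback {I : finiteIndexIdeals R (TruncatedPolynomial R n)} {f : R[X]} :
    f ∈ pullback I ↔ Ideal.Quotient.mk (Ideal.span {(X : R[X]) ^ n}) f ∈ I.1 := Iff.rfl

theorem cardQuot_pullback (I : finiteIndexIdeals R (TruncatedPolynomial R n)) :
    Submodule.cardQuot (pullback I) = Nat.card (TruncatedPolynomial R n ⧸ I.1) :=
  AddSubgroup.index_comap_of_surjective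
    (f := (Ideal.Quotient.mk (Ideal.span {(X : R[X]) ^ n})).toAddMonoidHom) I.1.toAddSubgroup
    Ideal.Quotient.mk_surjective

theorem pullback_mem (I : finiteIndexIdeals R (TruncatedPolynomial R n)) :
    (X : R[X]) ^ n ∈ pullback I ∧ Submodule.cardQuot (pullback I) ≠ 0 := by
  constructor
  · rw [mem_pullback, Ideal.Quotient.eq_zero_iff_mem.2 (Ideal.mem_span_singleton_self _)]
    exact I.1.zero_mem
  · have := I.2.2
    rw [cardQuot_pullback]
    exact Nat.card_pos.ne'

theorem pullback_bijective :
    Function.Bijective (fun I : finiteIndexIdeals R (TruncatedPolynomial R n) =>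
      (⟨pullback I, pullback_mem I⟩ : TruncIdeal R n)) := by
  constructor
  · intro I J h
    have h' : pullback I = pullback J := congrArg Subtype.val h
    refine Subtype.ext (Submodule.ext fun x => ?_)
    obtain ⟨f, rfl⟩ := Ideal.Quotient.mk_surjective x
    rw [← mem_pullback, ← mem_pullback, h']
  · intro T
    let q := Ideal.Quotient.mk (Ideal.span {(X : R[X]) ^ n})
    have hq : Function.Surjective q := Ideal.Quotient.mk_surjective
    have hT : (T.1.map q).comap q = T.1 := by
      rw [Ideal.comap_map_of_surjective' q hq, Ideal.mk_ker, sup_eq_left,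
        Ideal.span_singleton_le_iff_mem]
      exact T.2.1
    let S : Submodule R (TruncatedPolynomial R n) := (T.1.map q).restrictScalars R
    have hS : Submodule.cardQuot T.1 = Nat.card (TruncatedPolynomial R n ⧸ S) := by
      rw [← hT]
      exact AddSubgroup.index_comap_of_surjective (f := q.toAddMonoidHom) S.toAddSubgroup hq
    have hfin : Finite (TruncatedPolynomial R n ⧸ S) :=
      Nat.finite_of_card_ne_zero (hS ▸ T.2.2)
    refine ⟨⟨S, fun a x hx => ⟨(T.1.map q).mul_mem_left a hx, (T.1.map q).mul_mem_right a hx⟩,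
      hfin⟩, Subtype.ext ?_⟩
    exact hT

theorem truncTerm_pullback (s : ℂ) (I : finiteIndexIdeals R (TruncatedPolynomial R n)) :
    truncTerm R n s 0 ⟨pullback I, pullback_mem I⟩ =
      idealZetaTerm R (TruncatedPolynomial R n) s I := by
  rw [truncTerm, idealZetaTerm, cardQuot_pullback, neg_zero, Complex.cpow_zero, mul_one]

/-- The ideal zeta function of `R[X]/(X ^ n)` for an infinite principal ideal domain `R`. -/
theorem summable_and_idealZeta_eq_prod [IsDomain R] [IsPrincipalIdealRing R] [Infinite R] (s : ℂ)
    (h : ∀ j ∈ Finset.Icc 1 n, Summable (cardQuotTerm R (j * s - j + 1))) :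
    Summable (idealZetaTerm R (TruncatedPolynomial R n) s) ∧
      idealZeta R (TruncatedPolynomial R n) s =
        ∏ j ∈ Finset.Icc 1 n, ∑' D, cardQuotTerm R (j * s - j + 1) D := by
  obtain ⟨h1, h2⟩ := TruncIdeal.summable_and_tsum_truncTerm (R := R) n s 0 (by simpa using h)
  let e := Equiv.ofBijective _ (pullback_bijective (R := R) (n := n))
  constructor
  · exact ((e.summable_iff).2 h1).congr fun I => truncTerm_pullback s I
  · simp only [add_zero] at h2
    rw [← h2, ← e.tsum_eq]
    exact tsum_congr fun I => (truncTerm_pullback s I).symm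

end TruncatedPolynomial

end Comparison

/-! ### The zeta functions of `ℤ` and `ℤ_[p]`. -/

theorem Int.cardQuot_span_natCast (k : ℕ) :
    Submodule.cardQuot (Ideal.span {(k : ℤ)}) = k := by
  rw [← Ideal.absNorm_apply, Ideal.absNorm_span_singleton]
  simp

theorem Int.summable_and_tsum_cardQuotTerm {w : ℂ} (hw : 1 < w.re) :
    Summable (cardQuotTerm ℤ w) ∧ ∑' D, cardQuotTerm ℤ w D = riemannZeta w := by
  -- The generator is `k + 1` because the zero ideal has infinite index.
  let F (k : ℕ) : {D : Ideal ℤ // Submodule.cardQuot D ≠ 0} :=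
    ⟨Ideal.span {((k + 1 : ℕ) : ℤ)}, by rw [Int.cardQuot_span_natCast]; omega⟩
  have hF : Function.Bijective F := by
    constructor
    · intro k l h
      have := congrArg (fun D => Submodule.cardQuot D.1) h
      simp only [F, Int.cardQuot_span_natCast] at this
      omega
    · intro D
      have h0 : Ideal.absNorm D.1 ≠ 0 := by rw [Ideal.absNorm_apply]; exact D.2
      refine ⟨Ideal.absNorm D.1 - 1, Subtype.ext ?_⟩
      change Ideal.span {((Ideal.absNorm D.1 - 1 + 1 : ℕ) : ℤ)} = D.1
      rw [Nat.sub_add_cancel (Nat.pos_of_ne_zero h0), Int.ideal_span_absNorm_eq_self]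
  let e := Equiv.ofBijective F hF
  have he (k : ℕ) : cardQuotTerm ℤ w (e k) = 1 / ((k + 1 : ℕ) : ℂ) ^ w := by
    change (Submodule.cardQuot (Ideal.span {((k + 1 : ℕ) : ℤ)}) : ℂ) ^ (-w) = _
    rw [Int.cardQuot_span_natCast, Complex.cpow_neg, one_div]
  constructor
  · rw [← e.summable_iff]
    exact ((summable_nat_add_iff 1).2 (Complex.summable_one_div_nat_cpow.2 hw)).congr
      fun k => (he k).symm
  · rw [← e.tsum_eq, tsum_congr he, zeta_eq_tsum_one_div_nat_add_one_cpow hw]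
    simp

theorem PadicInt.cardQuot_span_pow (p : ℕ) [Fact p.Prime] (k : ℕ) :
    Submodule.cardQuot (Ideal.span {(p : ℤ_[p]) ^ k}) = p ^ k := by
  rw [Submodule.cardQuot_apply, ← PadicInt.ker_toZModPow,
    Nat.card_congr (RingHom.quotientKerEquivOfSurjective
      (ZMod.ringHom_surjective (PadicInt.toZModPow (p := p) k))).toEquiv, Nat.card_zmod]

theorem PadicInt.summable_and_tsum_cardQuotTerm (p : ℕ) [hp : Fact p.Prime] {w : ℂ}
    (hw : 0 < w.re) :
    Summable (cardQuotTerm ℤ_[p] w) ∧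
      ∑' D, cardQuotTerm ℤ_[p] w D = (1 - (p : ℂ) ^ (-w))⁻¹ := by
  let F (k : ℕ) : {D : Ideal ℤ_[p] // Submodule.cardQuot D ≠ 0} :=
    ⟨Ideal.span {(p : ℤ_[p]) ^ k}, by
      rw [PadicInt.cardQuot_span_pow]; exact pow_ne_zero _ hp.out.ne_zero⟩
  have hF : Function.Bijective F := by
    constructor
    · intro k l h
      have := congrArg (fun D => Submodule.cardQuot D.1) h
      simp only [F, PadicInt.cardQuot_span_pow] at this
      exact Nat.pow_right_injective hp.out.two_le this
    · intro D
      obtain ⟨k, hk⟩ := PadicInt.ideal_eq_span_pow_p (s := D.1) fun h =>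
        D.2 (h ▸ Submodule.cardQuot_bot_of_infinite)
      exact ⟨k, Subtype.ext hk.symm⟩
  let e := Equiv.ofBijective F hF
  have he (k : ℕ) : cardQuotTerm ℤ_[p] w (e k) = ((p : ℂ) ^ (-w)) ^ k := by
    change (Submodule.cardQuot (Ideal.span {(p : ℤ_[p]) ^ k}) : ℂ) ^ (-w) = _
    rw [PadicInt.cardQuot_span_pow, Nat.cast_pow, ← Complex.natCast_cpow_natCast_mul,
      Complex.cpow_nat_mul]
  have hlt : ‖(p : ℂ) ^ (-w)‖ < 1 := by
    rw [Complex.norm_natCast_cpow_of_pos hp.out.pos, Complex.neg_re]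
    exact Real.rpow_lt_one_of_one_lt_of_neg (by exact_mod_cast hp.out.one_lt) (by linarith)
  constructor
  · rw [← e.summable_iff]
    exact (summable_geometric_of_norm_lt_one hlt).congr fun k => (he k).symm
  · rw [← e.tsum_eq, tsum_congr he, tsum_geometric_of_norm_lt_one hlt]

theorem corollary4p3 (n : ℕ) (hn : 0 < n) :
    (∀ (p : ℕ) [Fact p.Prime] (s : ℂ), 1 - 1 / (n : ℝ) < s.re →
      Summable (idealZetaTerm ℤ_[p] (TruncatedPolynomial ℤ_[p] n) s) ∧
      idealZeta ℤ_[p] (TruncatedPolynomial ℤ_[p] n) s =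
        1 / ∏ j ∈ Finset.Icc 1 n, (1 - (p : ℂ) ^ ((j : ℂ) - 1 - (j : ℂ) * s))) ∧
    (∀ s : ℂ, 1 < s.re →
      Summable (idealZetaTerm ℤ (TruncatedPolynomial ℤ n) s) ∧
      idealZeta ℤ (TruncatedPolynomial ℤ n) s =
        ∏ j ∈ Finset.Icc 1 n, riemannZeta ((j : ℂ) * s - (j : ℂ) + 1)) := by
  have hre (j : ℕ) (s : ℂ) : ((j : ℂ) * s - j + 1).re = j * s.re - j + 1 := by simp
  constructor
  · intro p _ s hs
    -- The case `j = n` is the strictest: `1 - 1/j ≤ 1 - 1/n < s.re`.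
    have hw (j : ℕ) (hj : j ∈ Finset.Icc 1 n) : 0 < ((j : ℂ) * s - j + 1).re := by
      rw [hre]
      obtain ⟨h1, h2⟩ := Finset.mem_Icc.1 hj
      have h1' : (0 : ℝ) < j := by exact_mod_cast h1
      have h3 : 1 / (n : ℝ) ≤ 1 / j := one_div_le_one_div_of_le h1' (by exact_mod_cast h2)
      have h4 : (j : ℝ) * (1 - 1 / j) < j * s.re := mul_lt_mul_of_pos_left (by linarith) h1'
      rw [mul_sub, mul_one_div_cancel h1'.ne'] at h4
      linarith
    obtain ⟨h1, h2⟩ := TruncatedPolynomial.summable_and_idealZeta_eq_prod (R := ℤ_[p]) (n := n) s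
      fun j hj => (PadicInt.summable_and_tsum_cardQuotTerm p (hw j hj)).1
    refine ⟨h1, ?_⟩
    rw [h2, one_div, ← Finset.prod_inv_distrib]
    refine Finset.prod_congr rfl fun j hj => ?_
    rw [(PadicInt.summable_and_tsum_cardQuotTerm p (hw j hj)).2]
    congr 3
    ring
  · intro s hs
    have hw (j : ℕ) (hj : j ∈ Finset.Icc 1 n) : 1 < ((j : ℂ) * s - j + 1).re := by
      rw [hre]
      have h1 : (0 : ℝ) < j := by exact_mod_cast (Finset.mem_Icc.1 hj).1
      nlinarith
    obtain ⟨h1, h2⟩ := TruncatedPolynomial.summable_and_idealZeta_eq_prod (R := ℤ) (n := n) s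
      fun j hj => (Int.summable_and_tsum_cardQuotTerm (hw j hj)).1
    exact ⟨h1, h2.trans (Finset.prod_congr rfl fun j hj =>
      (Int.summable_and_tsum_cardQuotTerm (hw j hj)).2)⟩
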